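/- Let $n\ge 3$ and let $\mathrm{Gr}(1,\mathbb P^n)$ be the Grassmannian of lines in complex projective $n$-space, that is, of two-dimensional subspaces $L\subseteq\mathbb C^{n+1}$. The dual Plücker coordinates of $L$ are the minors $q_{jk}=b_{0j}b_{1k}-b_{0k}b_{1j}$, $0\le j<k\le n$, of a $2\times(n+1)$ matrix $(b_{ij})$ with row space $L$; they are determined up to a common nonzero factor, and one sets $q_{kj}=-q_{jk}$ and, accordingly, $\frac{\partial}{\partial q_{kj}}=-\frac{\partial}{\partial q_{jk}}$ for $j<k$. Let $\Sigma\subseteq\mathrm{Gr}(1,\mathbb P^n)$ be an irreducible hypersurface (an irreducible Zariski closed subset of codimension one) with equation $Q$: here $Q\in\mathbb C[q_{jk}\mid 0\le j<k\le n]$ is a homogeneous polynomial whose class generates the vanishing ideal of $\Sigma$ in the homogeneous coordinate ring of $\mathrm{Gr}(1,\mathbb P^n)$ (the polynomial ring modulo the ideal of all polynomials in the $q_{jk}$ that vanish on $\mathrm{Gr}(1,\mathbb P^n)$). The tangent space of $\mathrm{Gr}(1,\mathbb P^n)$ at $L$ is $\mathrm{Hom}(L,\mathbb C^{n+1}/L)$.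 The hypersurface $\Sigma$ is called coisotropic if, at every smooth point $L$ of $\Sigma$, the tangent hyperplane $T_L\Sigma\subseteq\mathrm{Hom}(L,\mathbb C^{n+1}/L)$ is the kernel of a linear form $f\mapsto\mathrm{tr}(f\circ\varphi)$ with $\varphi\in\mathrm{Hom}(\mathbb C^{n+1}/L,\,L)$ of rank one. For indices $j,k,i,m\in\{0,\dots,n\}$ put $$R^Q_{jkim}:=\frac{\partial Q}{\partial q_{jk}}\frac{\partial Q}{\partial q_{im}}-\frac{\partial Q}{\partial q_{ji}}\frac{\partial Q}{\partial q_{km}}+\frac{\partial Q}{\partial q_{jm}}\frac{\partial Q}{\partial q_{ki}}$$ (a permutation of the four indices multiplies this polynomial by the sign of the permutation). Theorem. $\Sigma$ is coisotropic if and only if, for all $0\le i<m\le n$, the polynomial $$\sum_{\substack{0\le j<k\le n\\ j,k\notin\{i,m\}}}q_{jk}\,R^Q_{jkim}$$ vanishes at every point of $\Sigma$. -/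

import Mathlib

noncomputable section

namespace LineGr

/-- The complex vector space with projectivization the projective space of dimension `n`. -/
abbrev Vec (n : ℕ) : Type := Fin (n + 1) → ℂ

/-- The Grassmannian of lines in projective `n`-space: the two-dimensional linear subspaces of
the vector space of dimension `n + 1`. -/
structure Gr (n : ℕ) : Type where
  /-- The linear subspace with projectivization the line. -/
  space : Submodule ℂ (Vec n)
  finrank_eq : Module.finrank ℂ space = 2

/-- The index set of the Plücker coordinates: pairs `j < k` of indices from `0` to `n`. -/
abbrev PIdx (n : ℕ) : Type := {p : Fin (n + 1) × Fin (n + 1) // p.1 < p.2}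

/-- Polynomials in the Plücker variables. -/
abbrev PPoly (n : ℕ) : Type := MvPolynomial (PIdx n) ℂ

/-- The maximal minors of a matrix with two rows. -/
def pl {n : ℕ} (B : Fin 2 → Vec n) : PIdx n → ℂ := fun p =>
  B 0 p.1.1 * B 1 p.1.2 - B 0 p.1.2 * B 1 p.1.1

/-- The differential of `pl` at `B` in the direction `B'`. -/
def plDiff {n : ℕ} (B B' : Fin 2 → Vec n) : PIdx n → ℂ := fun p =>
  (B' 0 p.1.1 * B 1 p.1.2 - B' 0 p.1.2 * B 1 p.1.1)
    + (B 0 p.1.1 * B' 1 p.1.2 - B 0 p.1.2 * B' 1 p.1.1)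

/-- The matrix whose two rows are the vectors of a basis of `L`. -/
def rows {n : ℕ} {L : Submodule ℂ (Vec n)} (b : Module.Basis (Fin 2) ℂ L) : Fin 2 → Vec n :=
  fun i => (b i : Vec n)

/-- `F` vanishes at (all vectors of dual Plücker coordinates of) the line `L`. The dual Plücker
coordinates of `L` are the maximal minors of a matrix with row space `L`. -/
def VanishesAt {n : ℕ} (F : PPoly n) (L : Gr n) : Prop :=
  ∀ b : Module.Basis (Fin 2) ℂ L.space, MvPolynomial.eval (pl (rows b)) F = 0

/-- The Zariski topology: the sets where a homogeneous polynomial in the Plücker coordinates does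
not vanish are a basis of open sets. -/
instance zariski (n : ℕ) : TopologicalSpace (Gr n) :=
  TopologicalSpace.generateFrom
    {U | ∃ (F : PPoly n) (d : ℕ), F.IsHomogeneous d ∧ U = {L | ¬ VanishesAt F L}}

/-- A closed irreducible subset of codimension one. -/
def IsIrreducibleHypersurface {n : ℕ} (S : Set (Gr n)) : Prop :=
  ∃ Z : TopologicalSpace.IrreducibleCloseds (Gr n), (Z : Set (Gr n)) = S ∧ Order.coheight Z = 1

/-- The ideal of polynomials in the Plücker variables that vanish on `S`. For `S` the whole
Grassmannian this is the ideal of Plücker relations. -/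
def vanishingIdeal {n : ℕ} (S : Set (Gr n)) : Ideal (PPoly n) where
  carrier := {F | ∀ L ∈ S, VanishesAt F L}
  add_mem' := by
    intro F G hF hG L hL b
    rw [map_add, hF L hL b, hG L hL b, add_zero]
  zero_mem' := by
    intro L _ b
    exact map_zero _
  smul_mem' := by
    intro c F hF L hL b
    rw [smul_eq_mul, map_mul, hF L hL b, mul_zero]

/-- `Q` is a defining polynomial of `S`: the class of `Q` in the coordinate ring of the
Grassmannian (the polynomials in the Plücker variables modulo those that vanish on the whole
Grassmannian) generates the ideal of `S`. -/
def IsEquationOf {n : ℕ} (Q : PPoly n) (S : Set (Gr n)) : Prop :=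
  vanishingIdeal S = Ideal.span {Q} ⊔ vanishingIdeal (Set.univ : Set (Gr n))

/-- The differential at `B`, in the direction `B'`, of the composition of `F` with `pl`. -/
def dComp {n : ℕ} (F : PPoly n) (B B' : Fin 2 → Vec n) : ℂ :=
  ∑ p : PIdx n, MvPolynomial.eval (pl B) (MvPolynomial.pderiv p F) * plDiff B B' p

/-- The linear maps `g` from `L` to the ambient vector space such that moving each basis
`(b 0, b 1)` of `L` in the direction `(g (b 0), g (b 1))` is, to first order, compatible with all
equations of `S`. -/
def liftedTangent {n : ℕ} (S : Set (Gr n)) (L : Gr n) : Submodule ℂ (L.space →ₗ[ℂ] Vec n) where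
  carrier := {g | ∀ F ∈ vanishingIdeal S, ∀ b : Module.Basis (Fin 2) ℂ L.space,
    dComp F (rows b) (fun i => g (b i)) = 0}
  add_mem' := by
    intro g h hg hh F hF b
    have e : (0 : ℂ) = dComp F (rows b) (fun i => g (b i))
        + dComp F (rows b) (fun i => h (b i)) := by
      rw [hg F hF b, hh F hF b, add_zero]
    rw [e]
    simp only [dComp, ← Finset.sum_add_distrib]
    refine Finset.sum_congr rfl fun p _ => ?_
    simp only [plDiff, LinearMap.add_apply, Pi.add_apply]
    ring
  zero_mem' := by
    intro F _ b
    simp [dComp, plDiff]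
  smul_mem' := by
    intro c g hg F hF b
    rw [← mul_zero c, ← hg F hF b]
    simp only [dComp, Finset.mul_sum]
    refine Finset.sum_congr rfl fun p _ => ?_
    simp only [plDiff, LinearMap.smul_apply, Pi.smul_apply, smul_eq_mul]
    ring

/-- The tangent space of the Grassmannian at `L`. -/
abbrev TangentGr {n : ℕ} (L : Gr n) : Type := L.space →ₗ[ℂ] (Vec n ⧸ L.space)

/-- The (Zariski) tangent space of `S` at `L`, as a subspace of the tangent space of the
Grassmannian at `L`. -/
def tangent {n : ℕ} (S : Set (Gr n)) (L : Gr n) : Submodule ℂ (TangentGr L) :=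
  (liftedTangent S L).map (LinearMap.compRight ℂ L.space.mkQ)

/-- `L` is a smooth point of the hypersurface `S`: the tangent space of `S` at `L` has the
dimension of `S`, which is one less than the dimension of the Grassmannian. -/
def IsSmoothPoint {n : ℕ} (S : Set (Gr n)) (L : Gr n) : Prop :=
  L ∈ S ∧ Module.finrank ℂ (tangent S L) + 1 = Module.finrank ℂ (TangentGr L)

/-- A subspace `H` of `Hom(U, V)` is a coisotropic hyperplane if it is the kernel of the linear
form `f ↦ tr (f ∘ φ)` for some `φ` in `Hom(V, U)` of rank one. -/
def IsCoisotropicHyperplane {U V : Type*} [AddCommGroup U] [Module ℂ U] [AddCommGroup V]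
    [Module ℂ V] (H : Submodule ℂ (U →ₗ[ℂ] V)) : Prop :=
  ∃ φ : V →ₗ[ℂ] U, Module.finrank ℂ (LinearMap.range φ) = 1 ∧
    ∀ f : U →ₗ[ℂ] V, f ∈ H ↔ LinearMap.trace ℂ V (f ∘ₗ φ) = 0

/-- Coisotropy of a hypersurface: at every smooth point the tangent hyperplane is coisotropic. -/
def IsCoisotropic {n : ℕ} (S : Set (Gr n)) : Prop :=
  ∀ L : Gr n, IsSmoothPoint S L → IsCoisotropicHyperplane (tangent S L)

/-- The partial derivative with respect to the Plücker variable with indices `j`, `k`, where the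
variable with indices `k`, `j` is minus the one with indices `j`, `k`. -/
def dq {n : ℕ} (Q : PPoly n) (j k : Fin (n + 1)) : PPoly n :=
  if h : j < k then MvPolynomial.pderiv ⟨(j, k), h⟩ Q
  else if h : k < j then - MvPolynomial.pderiv ⟨(k, j), h⟩ Q
  else 0

/-- The differential Plücker expression. -/
def R {n : ℕ} (Q : PPoly n) (j k i m : Fin (n + 1)) : PPoly n :=
  dq Q j k * dq Q i m - dq Q j i * dq Q k m + dq Q j m * dq Q k i

theorem dq_swap {n : ℕ} (Q : PPoly n) (j k : Fin (n + 1)) : dq Q k j = - dq Q j k := by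
  unfold dq
  rcases lt_trichotomy j k with h | h | h
  · simp [h, h.not_gt]
  · simp [h]
  · simp [h, h.not_gt]

/-- Permuting the four indices multiplies the differential Plücker expression by the sign. -/
theorem R_perm {n : ℕ} (Q : PPoly n) (v : Fin 4 → Fin (n + 1)) (π : Equiv.Perm (Fin 4)) :
    R Q (v (π 0)) (v (π 1)) (v (π 2)) (v (π 3))
      = ((Equiv.Perm.sign π : ℤ) : PPoly n) * R Q (v 0) (v 1) (v 2) (v 3) := by
  have key : ∀ (w : Fin 4 → Fin (n + 1)) (x y : Fin 4), x ≠ y →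
      R Q (w (Equiv.swap x y 0)) (w (Equiv.swap x y 1)) (w (Equiv.swap x y 2))
        (w (Equiv.swap x y 3)) = - R Q (w 0) (w 1) (w 2) (w 3) := by
    intro w x y hxy
    have s01 := dq_swap Q (w 0) (w 1)
    have s02 := dq_swap Q (w 0) (w 2)
    have s03 := dq_swap Q (w 0) (w 3)
    have s12 := dq_swap Q (w 1) (w 2)
    have s13 := dq_swap Q (w 1) (w 3)
    have s23 := dq_swap Q (w 2) (w 3)
    fin_cases x <;> fin_cases y <;> first
      | exact absurd rfl hxy
      | (simp [R, Equiv.swap_apply_def, s01, s02, s03, s12, s13, s23]; try ring)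
  induction π using Equiv.Perm.swap_induction_on generalizing v with
  | one => simp
  | swap_mul f x y hxy ih =>
    have h1 := ih (v ∘ Equiv.swap x y)
    simp only [Function.comp_apply] at h1
    rw [Equiv.Perm.sign_mul, Equiv.Perm.sign_swap hxy]
    simp only [Equiv.Perm.mul_apply]
    rw [h1, key v x y hxy]
    push_cast
    ring

/-- The sum, over all `j < k` different from `i` and `m`, of the Plücker variable with indices
`j`, `k` times the differential Plücker expression with indices `j`, `k`, `i`, `m`. -/
def cayleyPoly {n : ℕ} (Q : PPoly n) (i m : Fin (n + 1)) : PPoly n :=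
  ∑ p : PIdx n with p.1.1 ∉ ({i, m} : Finset (Fin (n + 1))) ∧
      p.1.2 ∉ ({i, m} : Finset (Fin (n + 1))),
    MvPolynomial.X p * R Q p.1.1 p.1.2 i m

end LineGr

end

/-! Let `M` be the antisymmetric matrix of partial derivatives of `Q` at the minors of a basis `b`
of a line `L` in `S`. The differential of `Q` in the direction `g` is `g (b 0) · M b 1 - g (b 1) · M
b 0`. Antisymmetry and Euler's identity make the forms `θ = · M b 0` and `η = · M b 1` vanish on
`L`, so they descend to the quotient by `L`. Hence the tangent space of `S` is the kernel of `f ↦ η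
(f (b 0)) - θ (f (b 1)) = tr (f ∘ φ)` with `φ = η ⊗ b 0 - θ ⊗ b 1` (`mem_tangent_iff`). The point is
smooth iff `φ ≠ 0`, and `φ` has rank at most one iff `θ ∧ η = 0` (`isCoisotropicHyperplane_iff`).
The Cayley polynomials evaluate to the coordinates of `θ ∧ η` up to sign (`eval_cayleyPoly`). At
singular points `θ = η = 0`, so they vanish there as well. -/

noncomputable section

namespace LineGr

open MvPolynomial Matrix

variable {n : ℕ}

/-! ### The gradient as an antisymmetric matrix, and Euler's identity. -/

/-- The antisymmetric matrix of partial derivatives of `Q` at the minors of `B`. -/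
def gradMatrix (Q : PPoly n) (B : Fin 2 → Vec n) : Matrix (Fin (n + 1)) (Fin (n + 1)) ℂ :=
  Matrix.of fun j k => eval (pl B) (dq Q j k)

theorem gradMatrix_swap (Q : PPoly n) (B : Fin 2 → Vec n) (j k : Fin (n + 1)) :
    gradMatrix Q B k j = -gradMatrix Q B j k := by
  simp [gradMatrix, dq_swap Q j k]

theorem gradMatrix_self (Q : PPoly n) (B : Fin 2 → Vec n) (j : Fin (n + 1)) :
    gradMatrix Q B j j = 0 := by
  simp [gradMatrix, dq]

theorem gradMatrix_of_lt (Q : PPoly n) (B : Fin 2 → Vec n) (p : PIdx n) :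
    gradMatrix Q B p.1.1 p.1.2 = eval (pl B) (pderiv p Q) := by
  simp [gradMatrix, dq, p.2]

theorem sum_sum_eq_sum_PIdx (F : Fin (n + 1) → Fin (n + 1) → ℂ) (h : ∀ j, F j j = 0) :
    ∑ j, ∑ k, F j k = ∑ p : PIdx n, (F p.1.1 p.1.2 + F p.1.2 p.1.1) := by
  have e1 : ∀ j k, F j k = (if j < k then F j k else 0) + if k < j then F j k else 0 := by
    intro j k
    rcases lt_trichotomy j k with hjk | rfl | hjk
    · simp [hjk, hjk.not_gt]
    · simp [h]
    · simp [hjk, hjk.not_gt]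
  have e2 : ∑ j, ∑ k, F j k = ∑ j, ∑ k, if j < k then F j k + F k j else 0 := by
    conv_lhs =>
      enter [2, j, 2, k]
      rw [e1]
    simp only [Finset.sum_add_distrib]
    rw [Finset.sum_comm (f := fun j k => if k < j then F j k else 0)]
    simp only [← Finset.sum_add_distrib]
    refine Finset.sum_congr rfl fun j _ => Finset.sum_congr rfl fun k _ => ?_
    split_ifs <;> simp
  rw [e2, ← Fintype.sum_prod_type'
    (f := fun j k => if j < k then F j k + F k j else 0), ← Finset.sum_filter]
  exact Finset.sum_subtype _ (by simp) fun p : Fin (n + 1) × Fin (n + 1) => F p.1 p.2 + F p.2 p.1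

theorem dComp_eq (Q : PPoly n) (B B' : Fin 2 → Vec n) :
    dComp Q B B' = B' 0 ⬝ᵥ (gradMatrix Q B *ᵥ B 1) - B' 1 ⬝ᵥ (gradMatrix Q B *ᵥ B 0) := by
  have h : B' 0 ⬝ᵥ (gradMatrix Q B *ᵥ B 1) - B' 1 ⬝ᵥ (gradMatrix Q B *ᵥ B 0)
      = ∑ j, ∑ k, gradMatrix Q B j k * (B' 0 j * B 1 k - B' 1 j * B 0 k) := by
    simp only [dotProduct, mulVec, Finset.mul_sum, ← Finset.sum_sub_distrib]
    refine Finset.sum_congr rfl fun j _ => Finset.sum_congr rfl fun k _ => ?_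
    ring
  rw [h, sum_sum_eq_sum_PIdx _ (by simp [gradMatrix_self]), dComp]
  refine Finset.sum_congr rfl fun p _ => ?_
  rw [gradMatrix_swap Q B p.1.1 p.1.2, gradMatrix_of_lt, plDiff]
  ring

theorem eval_smul_of_isHomogeneous {σ : Type*} {F : MvPolynomial σ ℂ} {e : ℕ}
    (hF : F.IsHomogeneous e) (c : ℂ) (x : σ → ℂ) : eval (c • x) F = c ^ e * eval x F := by
  rw [eval_eq, eval_eq, Finset.mul_sum]
  refine Finset.sum_congr rfl fun s hs => ?_
  have h : ∑ i ∈ s.support, s i = e := by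
    rw [← hF (mem_support_iff.mp hs), Finsupp.weight_apply, Finsupp.sum]
    simp
  simp only [Pi.smul_apply, smul_eq_mul, mul_pow, Finset.prod_mul_distrib,
    Finset.prod_pow_eq_pow_sum, h]
  ring

/-- For `d = 0` the truncated exponent is harmless, since all partial derivatives are zero. -/
theorem gradMatrix_of_pl_eq_smul {Q : PPoly n} {d : ℕ} (hd : Q.IsHomogeneous d)
    {B C : Fin 2 → Vec n} {c : ℂ} (h : pl C = c • pl B) :
    gradMatrix Q C = c ^ (d - 1) • gradMatrix Q B := by
  ext j k
  simp only [gradMatrix, of_apply, Matrix.smul_apply, smul_eq_mul, h, dq]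
  split_ifs <;> simp [eval_smul_of_isHomogeneous hd.pderiv]

theorem dotProduct_gradMatrix_mulVec_self (Q : PPoly n) (B : Fin 2 → Vec n) (x : Vec n) :
    x ⬝ᵥ (gradMatrix Q B *ᵥ x) = 0 := by
  simp only [dotProduct, mulVec, Finset.mul_sum]
  rw [sum_sum_eq_sum_PIdx _ (by simp [gradMatrix_self])]
  refine Finset.sum_eq_zero fun p _ => ?_
  rw [gradMatrix_swap Q B p.1.1 p.1.2]
  ring

theorem dotProduct_gradMatrix_mulVec_comm (Q : PPoly n) (B : Fin 2 → Vec n) (x y : Vec n) :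
    y ⬝ᵥ (gradMatrix Q B *ᵥ x) = -(x ⬝ᵥ (gradMatrix Q B *ᵥ y)) := by
  have h := dotProduct_gradMatrix_mulVec_self Q B (x + y)
  simp only [mulVec_add, add_dotProduct, dotProduct_add,
    dotProduct_gradMatrix_mulVec_self] at h
  linear_combination h

/-- Euler's identity. -/
theorem dotProduct_gradMatrix_mulVec {Q : PPoly n} {d : ℕ} (hd : Q.IsHomogeneous d)
    (B : Fin 2 → Vec n) : B 0 ⬝ᵥ (gradMatrix Q B *ᵥ B 1) = d * eval (pl B) Q := by
  have h := congrArg (eval (pl B)) hd.sum_X_mul_pderiv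
  simp only [map_sum, map_mul, eval_X, nsmul_eq_mul, map_natCast] at h
  rw [← h]
  simp only [dotProduct, mulVec, Finset.mul_sum]
  rw [sum_sum_eq_sum_PIdx _ (by simp [gradMatrix_self])]
  refine Finset.sum_congr rfl fun p _ => ?_
  rw [gradMatrix_swap Q B p.1.1 p.1.2, gradMatrix_of_lt, pl]
  ring

/-! ### Cayley polynomials as two-by-two minors. -/

theorem eval_cayleyPoly {Q : PPoly n} {d : ℕ} (hd : Q.IsHomogeneous d)
    (B : Fin 2 → Vec n) (hB : eval (pl B) Q = 0) (i m : Fin (n + 1)) :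
    eval (pl B) (cayleyPoly Q i m) = (gradMatrix Q B *ᵥ B 0) m * (gradMatrix Q B *ᵥ B 1) i
      - (gradMatrix Q B *ᵥ B 0) i * (gradMatrix Q B *ᵥ B 1) m := by
  have hR : ∀ j k, eval (pl B) (R Q j k i m) = gradMatrix Q B j k * gradMatrix Q B i m
      - gradMatrix Q B i j * gradMatrix Q B m k + gradMatrix Q B m j * gradMatrix Q B i k := by
    intro j k
    rw [gradMatrix_swap Q B j i, gradMatrix_swap Q B k m, gradMatrix_swap Q B j m,
      gradMatrix_swap Q B k i]
    simp [R, gradMatrix]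
  have e0 := dotProduct_gradMatrix_mulVec hd B
  rw [hB, mul_zero] at e0
  have h : eval (pl B) (cayleyPoly Q i m) = ∑ p : PIdx n, pl B p *
      eval (pl B) (R Q p.1.1 p.1.2 i m) := by
    rw [cayleyPoly, map_sum, Finset.sum_filter]
    refine Finset.sum_congr rfl fun p _ => ?_
    split_ifs with hp
    · simp
    -- The pairs left out of the sum contribute nothing: `R` with a repeated index is zero.
    · rw [hR]
      suffices H : gradMatrix Q B p.1.1 p.1.2 * gradMatrix Q B i m
          - gradMatrix Q B i p.1.1 * gradMatrix Q B m p.1.2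
          + gradMatrix Q B m p.1.1 * gradMatrix Q B i p.1.2 = 0 by rw [H, mul_zero]
      simp only [Finset.mem_insert, Finset.mem_singleton] at hp
      have hp' : p.1.1 = i ∨ p.1.1 = m ∨ p.1.2 = i ∨ p.1.2 = m := by tauto
      rcases hp' with h | h | h | h <;> rw [h] <;> simp only [gradMatrix_self]
      · rw [gradMatrix_swap Q B i m]; ring
      · ring
      · rw [gradMatrix_swap Q B i p.1.1, gradMatrix_swap Q B i m]; ring
      · rw [gradMatrix_swap Q B m p.1.1]; ring
  -- The first product in `R` sums to the Euler term `B 0 · M B 1`, which is zero on `S`; the other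
  -- two give the minor.
  have e1 : (gradMatrix Q B *ᵥ B 0) m * (gradMatrix Q B *ᵥ B 1) i
      - (gradMatrix Q B *ᵥ B 0) i * (gradMatrix Q B *ᵥ B 1) m
      + (B 0 ⬝ᵥ (gradMatrix Q B *ᵥ B 1)) * gradMatrix Q B i m
      = ∑ j, ∑ k, B 0 j * B 1 k * (gradMatrix Q B j k * gradMatrix Q B i m
      - gradMatrix Q B i j * gradMatrix Q B m k + gradMatrix Q B m j * gradMatrix Q B i k) := by
    simp only [dotProduct, mulVec, Finset.mul_sum, Finset.sum_mul, ← Finset.sum_sub_distrib,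
      ← Finset.sum_add_distrib]
    have h1 := Finset.sum_comm (s := Finset.univ) (t := Finset.univ)
      (f := fun k j => gradMatrix Q B m j * B 0 j * (gradMatrix Q B i k * B 1 k))
    have h2 := Finset.sum_comm (s := Finset.univ) (t := Finset.univ)
      (f := fun k j => gradMatrix Q B i j * B 0 j * (gradMatrix Q B m k * B 1 k))
    simp only [Finset.sum_add_distrib, Finset.sum_sub_distrib]
    rw [h1, h2]
    simp only [← Finset.sum_sub_distrib, ← Finset.sum_add_distrib]
    refine Finset.sum_congr rfl fun j _ => Finset.sum_congr rfl fun k _ => ?_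
    ring
  rw [e0, zero_mul, add_zero] at e1
  rw [e1, h, sum_sum_eq_sum_PIdx]
  · refine Finset.sum_congr rfl fun p _ => ?_
    rw [hR, pl, gradMatrix_swap Q B p.1.1 p.1.2]
    ring
  · intro j
    rw [gradMatrix_self]
    ring

/-! ### Linear algebra of coisotropic hyperplanes. -/

theorem trace_comp_sub_smulRight {U V : Type*} [AddCommGroup U] [Module ℂ U] [AddCommGroup V]
    [Module ℂ V] [FiniteDimensional ℂ V] (θ η : V →ₗ[ℂ] ℂ) (x y : U) (f : U →ₗ[ℂ] V) :
    LinearMap.trace ℂ V (f ∘ₗ (η.smulRight x - θ.smulRight y)) = η (f x) - θ (f y) := by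
  have h : f ∘ₗ (η.smulRight x - θ.smulRight y) = η.smulRight (f x) - θ.smulRight (f y) := by
    ext v
    simp
  rw [h, map_sub, LinearMap.trace_smulRight, LinearMap.trace_smulRight]

/-- The coordinates of the image of `v` are `η v` and `-θ v`; proportional forms keep them on one
line. -/
theorem finrank_range_sub_smulRight {U V : Type*} [AddCommGroup U] [Module ℂ U]
    [AddCommGroup V] [Module ℂ V] (b : Module.Basis (Fin 2) ℂ U) {θ η : V →ₗ[ℂ] ℂ}
    (h : ∀ v w, θ v * η w - θ w * η v = 0) (h0 : ∃ v, θ v ≠ 0 ∨ η v ≠ 0) :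
    Module.finrank ℂ (LinearMap.range (η.smulRight (b 0) - θ.smulRight (b 1))) = 1 := by
  obtain ⟨v, hv⟩ := h0
  set φ := η.smulRight (b 0) - θ.smulRight (b 1) with hφ
  have hφv : φ v ≠ 0 := by
    intro e
    have e0 := congrArg (b.repr · 0) e
    have e1 := congrArg (b.repr · 1) e
    simp [hφ] at e0 e1
    tauto
  refine (finrank_eq_one_iff_of_nonzero' (⟨φ v, v, rfl⟩ : LinearMap.range φ)
    (by simpa [Subtype.ext_iff] using hφv)).2 ?_
  rintro ⟨_, w, rfl⟩
  rcases hv with hv | hv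
  · refine ⟨θ w / θ v, Subtype.ext ?_⟩
    have e : θ w / θ v * η v = η w := by
      field_simp
      linear_combination -h v w
    simp [hφ, smul_sub, smul_smul, e, hv]
  · refine ⟨η w / η v, Subtype.ext ?_⟩
    have e : η w / η v * θ v = θ w := by
      field_simp
      linear_combination h v w
    simp [hφ, smul_sub, smul_smul, e, hv]

theorem isCoisotropicHyperplane_iff {U V : Type*} [AddCommGroup U] [Module ℂ U]
    [AddCommGroup V] [Module ℂ V] [FiniteDimensional ℂ V] (b : Module.Basis (Fin 2) ℂ U)
    (θ η : V →ₗ[ℂ] ℂ) (H : Submodule ℂ (U →ₗ[ℂ] V))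
    (hH : ∀ f, f ∈ H ↔ η (f (b 0)) - θ (f (b 1)) = 0) :
    (Module.finrank ℂ H + 1 = Module.finrank ℂ (U →ₗ[ℂ] V) → IsCoisotropicHyperplane H) ↔
      ∀ v w, θ v * η w - θ w * η v = 0 := by
  have : FiniteDimensional ℂ U := b.finiteDimensional_of_finite
  let τ : (U →ₗ[ℂ] V) →ₗ[ℂ] ℂ := η ∘ₗ LinearMap.applyₗ (b 0) - θ ∘ₗ LinearMap.applyₗ (b 1)
  have hτ : ∀ f, τ f = η (f (b 0)) - θ (f (b 1)) := fun f => rfl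
  have hker : H = LinearMap.ker τ := by
    ext f
    rw [hH, LinearMap.mem_ker, hτ]
  have hη : ∀ v, τ ((b.coord 0).smulRight v) = η v := by
    intro v
    simp [hτ]
  have hθ : ∀ v, τ ((b.coord 1).smulRight v) = -θ v := by
    intro v
    simp [hτ]
  constructor
  · intro h v w
    by_cases h0 : τ = 0
    · rw [← hη, ← hη, h0]
      simp
    · obtain ⟨φ, hφ, hφH⟩ := h (by rw [hker]; exact Module.Dual.finrank_ker_add_one_of_ne_zero h0)
      let σ : (U →ₗ[ℂ] V) →ₗ[ℂ] ℂ := LinearMap.trace ℂ V ∘ₗ LinearMap.lcomp ℂ V φ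
      have hσ : ∀ f, σ f = LinearMap.trace ℂ V (f ∘ₗ φ) := fun f => rfl
      -- A form vanishing on the kernel of another is a multiple of it, so `η` and `-θ` are
      -- multiples of the coordinates of `φ`, whose range is a line.
      have hστ : τ ∈ Submodule.span ℂ (Set.range fun _ : Unit => σ) := by
        refine FiniteDimensional.mem_span_of_iInf_ker_le_ker ?_
        intro f hf
        rw [← hker, hφH, ← hσ]
        simpa using hf
      rw [Set.range_const, Submodule.mem_span_singleton] at hστ
      obtain ⟨c, hc⟩ := hστ
      have hcoord : ∀ i v, τ ((b.coord i).smulRight v) = c * b.coord i (φ v) := by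
        intro i v
        have e : (b.coord i).smulRight v ∘ₗ φ = ((b.coord i) ∘ₗ φ).smulRight v := by
          ext x
          simp
        rw [← hc, LinearMap.smul_apply, hσ, e, LinearMap.trace_smulRight, smul_eq_mul]
        rfl
      obtain ⟨z, -, hz⟩ := finrank_eq_one_iff'.1 hφ
      obtain ⟨s, hs⟩ := hz ⟨φ v, v, rfl⟩
      obtain ⟨t, ht⟩ := hz ⟨φ w, w, rfl⟩
      have hs' : φ v = s • (z : U) := congrArg Subtype.val hs.symm
      have ht' : φ w = t • (z : U) := congrArg Subtype.val ht.symm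
      have e1 := hcoord 0 v
      have e2 := hcoord 0 w
      have e3 := hcoord 1 v
      have e4 := hcoord 1 w
      rw [hη, hs', map_smul, smul_eq_mul] at e1
      rw [hη, ht', map_smul, smul_eq_mul] at e2
      rw [hθ, hs', map_smul, smul_eq_mul, neg_eq_iff_eq_neg] at e3
      rw [hθ, ht', map_smul, smul_eq_mul, neg_eq_iff_eq_neg] at e4
      rw [e1, e2, e3, e4]
      ring
  · intro h hdim
    refine ⟨η.smulRight (b 0) - θ.smulRight (b 1), finrank_range_sub_smulRight b h ?_, ?_⟩
    -- The dimension hypothesis excludes `θ = η = 0`.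
    · by_contra! h0
      have : H = ⊤ := by
        ext f
        simp [hH, h0]
      rw [this, finrank_top] at hdim
      omega
    · intro f
      rw [hH, trace_comp_sub_smulRight]

/-! ### Differentials of the Plücker relations. -/

theorem hasDerivAt_eval {σ : Type*} [Fintype σ] (F : MvPolynomial σ ℂ) {x : ℂ → σ → ℂ}
    {x' : σ → ℂ} {t : ℂ} (hx : ∀ p, HasDerivAt (fun s => x s p) (x' p) t) :
    HasDerivAt (fun s => eval (x s) F) (∑ p, eval (x t) (pderiv p F) * x' p) t := by
  classical
  induction F using MvPolynomial.induction_on with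
  | C a => simpa using hasDerivAt_const t a
  | add F G hF hG =>
    simp only [map_add, add_mul, Finset.sum_add_distrib]
    exact hF.add hG
  | mul_X F i hF =>
    have h := hF.mul (hx i)
    simp only [map_mul, eval_X]
    refine h.congr_deriv ?_
    simp only [Derivation.leibniz, pderiv_X, smul_eq_mul, map_add, map_mul, eval_X, add_mul,
      Finset.sum_add_distrib, Finset.sum_mul]
    have e : ∑ p, eval (x t) F * eval (x t) ((Pi.single p 1 : σ → MvPolynomial σ ℂ) i) * x' p
        = eval (x t) F * x' i := by
      rw [Finset.sum_eq_single i]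
      · simp
      · intro p _ hp
        simp [hp.symm]
      · simp
    rw [e, add_comm]
    exact congrArg _ (Finset.sum_congr rfl fun p _ => by ring)

theorem linearIndependent_of_pl_ne_zero {B : Fin 2 → Vec n} {p : PIdx n} (hp : pl B p ≠ 0) :
    LinearIndependent ℂ B := by
  rw [Fintype.linearIndependent_iff]
  intro g hg
  have e1 := congrFun hg p.1.1
  have e2 := congrFun hg p.1.2
  simp only [Fin.sum_univ_two, Pi.add_apply, Pi.smul_apply, smul_eq_mul, Pi.zero_apply] at e1 e2
  have h0 : g 0 * pl B p = 0 := by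
    rw [pl]
    linear_combination B 1 p.1.2 * e1 - B 1 p.1.1 * e2
  have h1 : g 1 * pl B p = 0 := by
    rw [pl]
    linear_combination B 0 p.1.1 * e2 - B 0 p.1.2 * e1
  intro i
  fin_cases i
  · exact (mul_eq_zero.1 h0).resolve_right hp
  · exact (mul_eq_zero.1 h1).resolve_right hp

theorem exists_pl_ne_zero {B : Fin 2 → Vec n} (hB : LinearIndependent ℂ B) :
    ∃ p, pl B p ≠ 0 := by
  by_contra! h
  have hall : ∀ j k, B 0 j * B 1 k = B 0 k * B 1 j := by
    intro j k
    rcases lt_trichotomy j k with hjk | rfl | hjk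
    · exact sub_eq_zero.1 (h ⟨(j, k), hjk⟩)
    · rfl
    · exact (sub_eq_zero.1 (h ⟨(k, j), hjk⟩)).symm
  obtain ⟨k, hk⟩ := Function.ne_iff.1 (hB.ne_zero 1)
  have := Fintype.linearIndependent_iff.1 hB ![B 1 k, -B 0 k] (by
    ext j
    simp [Fin.sum_univ_two]
    linear_combination hall j k) 0
  exact hk this

theorem eval_pl_eq_zero_of_mem_vanishingIdeal_univ {P : PPoly n}
    (hP : P ∈ vanishingIdeal (Set.univ : Set (Gr n))) {B : Fin 2 → Vec n}
    (hB : LinearIndependent ℂ B) : eval (pl B) P = 0 := by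
  have h := hP ⟨Submodule.span ℂ (Set.range B), by
    simpa using finrank_span_eq_card hB⟩ trivial (Module.Basis.span hB)
  have e : rows (Module.Basis.span hB) = B := by
    funext i
    exact congrArg Subtype.val (Module.Basis.span_apply hB i)
  rwa [e] at h

/-- The rows of `B + s • B'` stay independent for small `s`, because a nonzero minor stays nonzero.
So `P` vanishes along this curve near `s = 0`, and so does its derivative at `0`. -/
theorem dComp_eq_zero_of_mem_vanishingIdeal_univ {P : PPoly n}
    (hP : P ∈ vanishingIdeal (Set.univ : Set (Gr n))) {B : Fin 2 → Vec n}
    (hB : LinearIndependent ℂ B) (B' : Fin 2 → Vec n) : dComp P B B' = 0 := by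
  have hx : ∀ p, HasDerivAt (fun s : ℂ => pl (B + s • B') p) (plDiff B B' p) 0 := by
    intro p
    have hl : ∀ i j, HasDerivAt (fun s : ℂ => (B + s • B') i j) (B' i j) 0 := by
      intro i j
      simpa using ((hasDerivAt_id (0 : ℂ)).mul_const (B' i j)).const_add (B i j)
    have := ((hl 0 p.1.1).mul (hl 1 p.1.2)).sub ((hl 0 p.1.2).mul (hl 1 p.1.1))
    refine this.congr_deriv ?_
    simp [plDiff]
    ring
  have hd := hasDerivAt_eval P hx
  obtain ⟨p, hp⟩ := exists_pl_ne_zero hB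
  have hev : (fun s : ℂ => eval (pl (B + s • B')) P) =ᶠ[nhds 0] fun _ => 0 := by
    have hne : ∀ᶠ s in nhds (0 : ℂ), pl (B + s • B') p ≠ 0 :=
      (hx p).continuousAt.eventually_ne (by simpa using hp)
    filter_upwards [hne] with s hs
    exact eval_pl_eq_zero_of_mem_vanishingIdeal_univ hP (linearIndependent_of_pl_ne_zero hs)
  have h0 := hd.unique ((hasDerivAt_const (0 : ℂ) (0 : ℂ)).congr_of_eventuallyEq hev)
  simpa [dComp] using h0

theorem linearIndependent_rows {L : Submodule ℂ (Vec n)} (b : Module.Basis (Fin 2) ℂ L) :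
    LinearIndependent ℂ (rows b) :=
  b.linearIndependent.map' L.subtype L.ker_subtype

/-! ### The tangent space cut out by `Q` in a single basis. -/

theorem dComp_add (F G : PPoly n) (B B' : Fin 2 → Vec n) :
    dComp (F + G) B B' = dComp F B B' + dComp G B B' := by
  simp [dComp, add_mul, Finset.sum_add_distrib]

theorem dComp_mul (F G : PPoly n) (B B' : Fin 2 → Vec n) :
    dComp (F * G) B B' = eval (pl B) F * dComp G B B' + eval (pl B) G * dComp F B B' := by
  simp only [dComp, Derivation.leibniz, smul_eq_mul, map_add, map_mul, Finset.mul_sum,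
    ← Finset.sum_add_distrib]
  exact Finset.sum_congr rfl fun p _ => by ring

theorem rows_eq_sum {L : Submodule ℂ (Vec n)} (b c : Module.Basis (Fin 2) ℂ L) (i : Fin 2) :
    rows c i = b.repr (c i) 0 • rows b 0 + b.repr (c i) 1 • rows b 1 := by
  have h := congrArg Subtype.val (b.sum_repr (c i))
  rw [Fin.sum_univ_two] at h
  exact h.symm

/-- A change of the basis multiplies the differential of a homogeneous polynomial by a power of
the determinant. -/
theorem dComp_rows_eq_mul {Q : PPoly n} {d : ℕ} (hd : Q.IsHomogeneous d)
    {L : Submodule ℂ (Vec n)} (g : L →ₗ[ℂ] Vec n) (b c : Module.Basis (Fin 2) ℂ L) :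
    ∃ a : ℂ, dComp Q (rows c) (fun i => g (c i)) = a * dComp Q (rows b) (fun i => g (b i)) := by
  have hg : ∀ i, g (c i) = b.repr (c i) 0 • g (b 0) + b.repr (c i) 1 • g (b 1) := by
    intro i
    rw [← map_smul g, ← map_smul g, ← map_add g,
      ← Fin.sum_univ_two (fun j => b.repr (c i) j • b j), b.sum_repr]
  have hr := rows_eq_sum b c
  have hpl : pl (rows c) = (b.repr (c 0) 0 * b.repr (c 1) 1 - b.repr (c 0) 1 * b.repr (c 1) 0) •
      pl (rows b) := by
    funext p
    simp only [pl, hr, Pi.add_apply, Pi.smul_apply, smul_eq_mul]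
    ring
  -- The gradient scales by the determinant to the power `d - 1`; the alternating pairing of `g`
  -- with it supplies one more factor.
  refine ⟨(b.repr (c 0) 0 * b.repr (c 1) 1 - b.repr (c 0) 1 * b.repr (c 1) 0) ^ (d - 1) *
    (b.repr (c 0) 0 * b.repr (c 1) 1 - b.repr (c 0) 1 * b.repr (c 1) 0), ?_⟩
  rw [dComp_eq, dComp_eq, gradMatrix_of_pl_eq_smul hd hpl, hr 0, hr 1]
  simp only [hg, smul_mulVec, mulVec_add, mulVec_smul, add_dotProduct, dotProduct_add,
    smul_dotProduct, dotProduct_smul, smul_eq_mul]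
  ring

theorem IsEquationOf.mem_vanishingIdeal {S : Set (Gr n)} {Q : PPoly n} (hQ : IsEquationOf Q S) :
    Q ∈ vanishingIdeal S := by
  rw [hQ]
  exact Ideal.mem_sup_left (Ideal.subset_span rfl)

/-- Every equation of `S` is `A * Q + P` with `P` a Plücker relation. On `S` its differential is `A`
times that of `Q`. -/
theorem mem_liftedTangent_iff {S : Set (Gr n)} {Q : PPoly n} {d : ℕ} (hd : Q.IsHomogeneous d)
    (hQ : IsEquationOf Q S) {L : Gr n} (hL : L ∈ S) (b : Module.Basis (Fin 2) ℂ L.space)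
    (g : L.space →ₗ[ℂ] Vec n) :
    g ∈ liftedTangent S L ↔ dComp Q (rows b) (fun i => g (b i)) = 0 := by
  have hQS := hQ.mem_vanishingIdeal
  refine ⟨fun h => h Q hQS b, fun h F hF c => ?_⟩
  rw [hQ] at hF
  obtain ⟨_, hA, P, hP, rfl⟩ := Submodule.mem_sup.1 hF
  obtain ⟨A, rfl⟩ := Ideal.mem_span_singleton'.1 hA
  obtain ⟨a, ha⟩ := dComp_rows_eq_mul hd g b c
  rw [dComp_add, dComp_mul, hQS L hL c, ha, h,
    dComp_eq_zero_of_mem_vanishingIdeal_univ hP (linearIndependent_rows c)]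
  ring

/-- The form kills `rows b i` by antisymmetry and the other row by Euler's identity. -/
theorem exists_conormal_form {Q : PPoly n} {d : ℕ} (hd : Q.IsHomogeneous d)
    {L : Submodule ℂ (Vec n)} (b : Module.Basis (Fin 2) ℂ L) (hb : eval (pl (rows b)) Q = 0)
    (i : Fin 2) : ∃ θ : (Vec n ⧸ L) →ₗ[ℂ] ℂ,
      ∀ v, θ (L.mkQ v) = v ⬝ᵥ (gradMatrix Q (rows b) *ᵥ rows b i) := by
  have h01 := dotProduct_gradMatrix_mulVec hd (rows b)
  rw [hb, mul_zero] at h01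
  have h10 := dotProduct_gradMatrix_mulVec_comm Q (rows b) (rows b 0) (rows b 1)
  rw [h01, neg_zero] at h10
  refine ⟨L.liftQ ((dotProductBilin ℂ ℂ).flip (gradMatrix Q (rows b) *ᵥ rows b i)) ?_,
    fun v => rfl⟩
  intro v hv
  have hv' : v = b.repr ⟨v, hv⟩ 0 • rows b 0 + b.repr ⟨v, hv⟩ 1 • rows b 1 := by
    have h := congrArg Subtype.val (b.sum_repr ⟨v, hv⟩)
    rw [Fin.sum_univ_two] at h
    exact h.symm
  change v ⬝ᵥ (gradMatrix Q (rows b) *ᵥ rows b i) = 0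
  rw [hv', add_dotProduct, smul_dotProduct, smul_dotProduct]
  fin_cases i <;> simp [h01, h10, dotProduct_gradMatrix_mulVec_self]

theorem mem_tangent_iff {S : Set (Gr n)} {Q : PPoly n} {d : ℕ} (hd : Q.IsHomogeneous d)
    (hQ : IsEquationOf Q S) {L : Gr n} (hL : L ∈ S) (b : Module.Basis (Fin 2) ℂ L.space)
    {θ η : (Vec n ⧸ L.space) →ₗ[ℂ] ℂ}
    (hθ : ∀ v, θ (L.space.mkQ v) = v ⬝ᵥ (gradMatrix Q (rows b) *ᵥ rows b 0))
    (hη : ∀ v, η (L.space.mkQ v) = v ⬝ᵥ (gradMatrix Q (rows b) *ᵥ rows b 1))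
    (f : TangentGr L) : f ∈ tangent S L ↔ η (f (b 0)) - θ (f (b 1)) = 0 := by
  have key : ∀ g : L.space →ₗ[ℂ] Vec n, g ∈ liftedTangent S L ↔
      η (L.space.mkQ (g (b 0))) - θ (L.space.mkQ (g (b 1))) = 0 := by
    intro g
    rw [mem_liftedTangent_iff hd hQ hL b, dComp_eq, hθ, hη]
  constructor
  · rintro ⟨g, hg, rfl⟩
    exact (key g).1 hg
  · intro h
    obtain ⟨g, rfl⟩ := Module.projective_lifting_property L.space.mkQ f
      (Submodule.mkQ_surjective _)
    exact ⟨g, (key g).2 h, rfl⟩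

/-! ### The wedge in coordinates, and the conclusion. -/

theorem forall_wedge_eq_zero_iff (x y : Vec n) :
    (∀ v w : Vec n, (v ⬝ᵥ x) * (w ⬝ᵥ y) - (w ⬝ᵥ x) * (v ⬝ᵥ y) = 0) ↔
      ∀ i m, i < m → x m * y i - x i * y m = 0 := by
  constructor
  · intro h i m _
    simpa using h (Pi.single m 1) (Pi.single i 1)
  · intro h v w
    have hall : ∀ i m, x i * y m = x m * y i := by
      intro i m
      rcases lt_trichotomy i m with him | rfl | him
      · exact (sub_eq_zero.1 (h i m him)).symm
      · rfl
      · exact sub_eq_zero.1 (h m i him)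
    simp only [dotProduct, Finset.sum_mul_sum]
    rw [sub_eq_zero, Finset.sum_comm (γ := Fin (n + 1)) (f := fun i j => w i * x i * (v j * y j))]
    refine Finset.sum_congr rfl fun i _ => Finset.sum_congr rfl fun j _ => ?_
    linear_combination v i * w j * hall i j

theorem isCoisotropic_iff {S : Set (Gr n)} {Q : PPoly n} {d : ℕ} (hd : Q.IsHomogeneous d)
    (hQ : IsEquationOf Q S) : IsCoisotropic S ↔
      ∀ i m : Fin (n + 1), i < m → ∀ L ∈ S, VanishesAt (cayleyPoly Q i m) L := by
  have hQS := hQ.mem_vanishingIdeal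
  have key : ∀ L ∈ S, ∀ b : Module.Basis (Fin 2) ℂ L.space,
      (IsSmoothPoint S L → IsCoisotropicHyperplane (tangent S L)) ↔
        ∀ i m : Fin (n + 1), i < m → MvPolynomial.eval (pl (rows b)) (cayleyPoly Q i m) = 0 := by
    intro L hL b
    obtain ⟨θ, hθ⟩ := exists_conormal_form hd b (hQS L hL b) 0
    obtain ⟨η, hη⟩ := exists_conormal_form hd b (hQS L hL b) 1
    simp only [IsSmoothPoint, hL, true_and, eval_cayleyPoly hd (rows b) (hQS L hL b)]
    rw [isCoisotropicHyperplane_iff b θ η _ (mem_tangent_iff hd hQ hL b hθ hη),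
      ← forall_wedge_eq_zero_iff, (Submodule.mkQ_surjective L.space).forall₂]
    simp only [hθ, hη]
  constructor
  · intro h i m him L hL b
    exact (key L hL b).1 (h L) i m him
  · intro h L hL
    -- Coisotropy at `L` does not involve a basis, so one basis suffices here.
    exact (key L hL.1 (Module.finBasisOfFinrankEq ℂ L.space L.finrank_eq)).2
      (fun i m him => h i m him L hL.1 _) hL

end LineGr

end

theorem mainTheorem6 (n : ℕ) (hn : 3 ≤ n) (S : Set (LineGr.Gr n))
    (hS : LineGr.IsIrreducibleHypersurface S) (Q : LineGr.PPoly n) (d : ℕ)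
    (hd : Q.IsHomogeneous d) (hQ : LineGr.IsEquationOf Q S) :
    LineGr.IsCoisotropic S ↔
      ∀ i m : Fin (n + 1), i < m → ∀ L ∈ S, LineGr.VanishesAt (LineGr.cayleyPoly Q i m) L :=
  LineGr.isCoisotropic_iff hd hQ
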